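/- Let $a<b$ and $c<d$ be real numbers. Let $\{\varphi_i\}_{i=1}^n$ be a finite orthonormal system in the complex space $L_2[a,b]$ and let $h_1,\dots,h_n$ be essentially bounded real functions on $[c,d]$; let $\{\psi_j\}_{j=1}^m$ be a finite orthonormal system in $L_2[c,d]$ and let $p_1,\dots,p_m$ be essentially bounded real functions on $[a,b]$. Consider on the complex Hilbert space $L_2([a,b]\times[c,d])$ the bounded operators (which are self-adjoint) $$(T_1f)(x,y)=\int_a^b\Big(\sum_{i=1}^n\varphi_i(x)\overline{\varphi_i(s)}h_i(y)\Big)f(s,y)\,ds,\qquad (T_2f)(x,y)=\int_c^d\Big(\sum_{j=1}^m p_j(x)\psi_j(y)\overline{\psi_j(t)}\Big)f(x,t)\,dt .$$ For a measurable real function $u$ on an interval $I$, let $\operatorname{Essran}(u)$ be the set of all $\lambda\in\mathbb R$ such that $\{\xi\in I:\lambda-\varepsilon<u(\xi)<\lambda+\varepsilon\}$ has positive Lebesgue measure for every $\varepsilon>0$. For a bounded self-adjoint operator $T$, let $\sigma_{ess}(T)$ be the set of points of the spectrum $\sigma(T)$ that are not isolated points of $\sigma(T)$ which are eigenvalues of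 finite multiplicity. Then $$\sigma_{ess}(T_1+T_2)=\{0\}\cup\bigcup_{i=1}^n\operatorname{Essran}(h_i)\cup\bigcup_{j=1}^m\operatorname{Essran}(p_j).$$ -/

import Mathlib

open MeasureTheory
open scoped ENNReal ComplexConjugate

noncomputable section

/-- Lebesgue measure on the interval `[a, b]`. -/
abbrev intervalMeasure (a b : ℝ) : Measure ℝ := volume.restrict (Set.Icc a b)

/-- Lebesgue measure on the rectangle `[a, b] × [c, d]`, as a product measure. -/
abbrev rectangleMeasure (a b c d : ℝ) : Measure (ℝ × ℝ) :=
  (intervalMeasure a b).prod (intervalMeasure c d)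

theorem rectangleMeasure_eq (a b c d : ℝ) :
    rectangleMeasure a b c d = volume.restrict (Set.Icc a b ×ˢ Set.Icc c d) :=
  Measure.prod_restrict _ _

/-- The set of essential values of a real function `φ` with respect to `μ`. -/
def essRan {α : Type*} [MeasurableSpace α] (μ : Measure α) (φ : α → ℝ) : Set ℝ :=
  {l | ∀ ε : ℝ, 0 < ε → 0 < μ {ξ | l - ε < φ ξ ∧ φ ξ < l + ε}}

section Spectrum

variable {H : Type*} [NormedAddCommGroup H] [InnerProductSpace ℂ H]

/-- The discrete spectrum of a (self-adjoint) bounded operator: the eigenvalues of finite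
multiplicity that are isolated points of the spectrum. -/
def discreteSpectrum (T : H →L[ℂ] H) : Set ℂ :=
  {z | (∃ ε : ℝ, 0 < ε ∧ ∀ w ∈ spectrum ℂ T, dist w z < ε → w = z) ∧
    Module.End.HasEigenvalue (T : Module.End ℂ H) z ∧
    FiniteDimensional ℂ (Module.End.eigenspace (T : Module.End ℂ H) z)}

/-- The essential spectrum of a (self-adjoint) bounded operator: the complement of the discrete
spectrum in the spectrum. -/
def essentialSpectrum (T : H →L[ℂ] H) : Set ℂ :=
  spectrum ℂ T \ discreteSpectrum T

end Spectrum

/-- The partial integral in the first variable with kernel `k (x, s, y)`: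
`(x, y) ↦ ∫ k (x, s, y) f (s, y) dμ(s)`. -/
def partialInt₁ (μ : Measure ℝ) (k : ℝ → ℝ → ℝ → ℂ) (f : ℝ × ℝ → ℂ) : ℝ × ℝ → ℂ :=
  fun z => ∫ s, k z.1 s z.2 * f (s, z.2) ∂μ

/-- The partial integral in the second variable with kernel `k (x, t, y)`:
`(x, y) ↦ ∫ k (x, t, y) f (x, t) dν(t)`. -/
def partialInt₂ (ν : Measure ℝ) (k : ℝ → ℝ → ℝ → ℂ) (f : ℝ × ℝ → ℂ) : ℝ × ℝ → ℂ :=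
  fun z => ∫ t, k z.1 t z.2 * f (z.1, t) ∂ν

section Kernels

variable {μ ν : Measure ℝ}

/-- The degenerate kernel `k₁(x, s, y) = ∑ᵢ φᵢ(x) conj(φᵢ(s)) hᵢ(y)`. -/
def degenerateKernel₁ {n : ℕ} (φ : Fin n → Lp ℂ 2 μ) (h : Fin n → Lp ℝ ∞ ν) :
    ℝ → ℝ → ℝ → ℂ :=
  fun x s y => ∑ i, φ i x * conj (φ i s) * (h i y : ℂ)

/-- The degenerate kernel `k₂(x, t, y) = ∑ⱼ pⱼ(x) ψⱼ(y) conj(ψⱼ(t))`. -/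
def degenerateKernel₂ {m : ℕ} (p : Fin m → Lp ℝ ∞ μ) (ψ : Fin m → Lp ℂ 2 ν) :
    ℝ → ℝ → ℝ → ℂ :=
  fun x t y => ∑ j, (p j x : ℂ) * ψ j y * conj (ψ j t)

/-! Auxiliary facts: these partial integrals map `L²` linearly and boundedly to `L²`. -/

theorem eLpNorm_two_prod_mul [SFinite μ] [SFinite ν] {u v : ℝ → ℂ}
    (hu : AEStronglyMeasurable u μ) (hv : AEStronglyMeasurable v ν) :
    eLpNorm (fun z : ℝ × ℝ => u z.1 * v z.2) 2 (μ.prod ν) = eLpNorm u 2 μ * eLpNorm v 2 ν := by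
  simp only [eLpNorm_eq_lintegral_rpow_enorm_toReal two_ne_zero ENNReal.ofNat_ne_top,
    enorm_mul]
  rw [← ENNReal.mul_rpow_of_nonneg _ _ (by positivity)]
  congr 1
  rw [← lintegral_prod_mul (by fun_prop) (by fun_prop)]
  refine lintegral_congr fun z => ?_
  rw [ENNReal.mul_rpow_of_nonneg _ _ (by positivity)]

theorem eLpNorm_two_slice [SFinite μ] [SFinite ν] {f : ℝ × ℝ → ℂ}
    (hf : AEStronglyMeasurable f (μ.prod ν)) :
    ∫⁻ y, eLpNorm (fun s => f (s, y)) 2 μ ^ (2 : ℝ) ∂ν = eLpNorm f 2 (μ.prod ν) ^ (2 : ℝ) := by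
  simp only [eLpNorm_eq_lintegral_rpow_enorm_toReal two_ne_zero ENNReal.ofNat_ne_top,
    ENNReal.toReal_ofNat, ← ENNReal.rpow_mul]
  norm_num
  rw [lintegral_prod_symm _ (by fun_prop)]

theorem ae_memLp_slice [SFinite μ] [SFinite ν] {f : ℝ × ℝ → ℂ} (hf : MemLp f 2 (μ.prod ν)) :
    ∀ᵐ y ∂ν, MemLp (fun s => f (s, y)) 2 μ := by
  have hm : ∀ᵐ y ∂ν, AEStronglyMeasurable (fun s => f (s, y)) μ := by
    have := (hf.1.comp_measurePreserving (Measure.measurePreserving_swap (μ := ν) (ν := μ)))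
    exact this.prodMk_left
  have hmeas : AEMeasurable (fun y => ∫⁻ s, ‖f (s, y)‖ₑ ^ (2 : ℝ) ∂μ) ν := by
    have := (hf.1.comp_measurePreserving (Measure.measurePreserving_swap (μ := ν) (ν := μ)))
    exact (this.enorm.pow_const (2 : ℝ)).lintegral_prod_right'
  have hfin : ∫⁻ y, ∫⁻ s, ‖f (s, y)‖ₑ ^ (2 : ℝ) ∂μ ∂ν ≠ ∞ := by
    rw [← lintegral_prod_symm _ (hf.1.enorm.pow_const (2 : ℝ))]
    have := lintegral_rpow_enorm_lt_top_of_eLpNorm_lt_top two_ne_zero ENNReal.ofNat_ne_top hf.2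
    simpa using this.ne
  filter_upwards [hm, ae_lt_top' hmeas hfin] with y h1 h2
  refine ⟨h1, ?_⟩
  rw [eLpNorm_lt_top_iff_lintegral_rpow_enorm_lt_top two_ne_zero ENNReal.ofNat_ne_top]
  simpa using h2

/-- The coefficient of the slice `f (·, y)` along `φ`. -/
def sliceCoeff (φ : Lp ℂ 2 μ) (f : ℝ × ℝ → ℂ) : ℝ → ℂ :=
  fun y => ∫ s, conj (φ s) * f (s, y) ∂μ

theorem memLp_conj (φ : Lp ℂ 2 μ) : MemLp (fun s => conj (φ s)) 2 μ :=
  (Lp.memLp φ).star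

theorem aestronglyMeasurable_sliceCoeff [SFinite μ] [SFinite ν] (φ : Lp ℂ 2 μ)
    {f : ℝ × ℝ → ℂ} (hf : AEStronglyMeasurable f (μ.prod ν)) :
    AEStronglyMeasurable (sliceCoeff φ f) ν := by
  have h0 : AEStronglyMeasurable (fun z : ℝ × ℝ => f (z.2, z.1)) (ν.prod μ) :=
    hf.comp_measurePreserving (Measure.measurePreserving_swap (μ := ν) (ν := μ))
  have h1 : AEStronglyMeasurable (fun z : ℝ × ℝ => conj (φ z.2) * f (z.2, z.1)) (ν.prod μ) :=
    ((memLp_conj φ).1.comp_snd).mul h0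
  exact h1.integral_prod_right'

theorem enorm_sliceCoeff_le (φ : Lp ℂ 2 μ) {f : ℝ × ℝ → ℂ} {y : ℝ}
    (hf : MemLp (fun s => f (s, y)) 2 μ) :
    ‖sliceCoeff φ f y‖ₑ ≤ eLpNorm φ 2 μ * eLpNorm (fun s => f (s, y)) 2 μ := by
  have h0 : eLpNorm (fun s => conj (φ s)) 2 μ = eLpNorm φ 2 μ :=
    eLpNorm_congr_norm_ae (by simp)
  have h1 : eLpNorm ((fun s => conj (φ s)) • fun s => f (s, y)) 1 μ ≤
      eLpNorm (fun s => conj (φ s)) 2 μ * eLpNorm (fun s => f (s, y)) 2 μ :=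
    eLpNorm_smul_le_mul_eLpNorm (p := 2) (q := 2) (r := 1) hf.1 (memLp_conj φ).1
  calc ‖sliceCoeff φ f y‖ₑ ≤ ∫⁻ s, ‖conj (φ s) * f (s, y)‖ₑ ∂μ :=
        enorm_integral_le_lintegral_enorm _
    _ = eLpNorm ((fun s => conj (φ s)) • fun s => f (s, y)) 1 μ := by
        rw [eLpNorm_one_eq_lintegral_enorm]; rfl
    _ ≤ eLpNorm (fun s => conj (φ s)) 2 μ * eLpNorm (fun s => f (s, y)) 2 μ := h1
    _ = _ := by rw [h0]

theorem eLpNorm_sliceCoeff_le [SFinite μ] [SFinite ν] (φ : Lp ℂ 2 μ)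
    {f : ℝ × ℝ → ℂ} (hf : MemLp f 2 (μ.prod ν)) :
    eLpNorm (sliceCoeff φ f) 2 ν ≤ eLpNorm φ 2 μ * eLpNorm f 2 (μ.prod ν) := by
  rw [← ENNReal.rpow_le_rpow_iff (z := 2) (by norm_num),
    ENNReal.mul_rpow_of_nonneg _ _ (by norm_num), ← eLpNorm_two_slice hf.1,
    ← lintegral_const_mul' _ _ (ENNReal.rpow_ne_top_of_nonneg (by norm_num) (Lp.memLp φ).2.ne)]
  have : eLpNorm (sliceCoeff φ f) 2 ν ^ (2 : ℝ) = ∫⁻ y, ‖sliceCoeff φ f y‖ₑ ^ (2 : ℝ) ∂ν := by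
    rw [eLpNorm_eq_lintegral_rpow_enorm_toReal two_ne_zero ENNReal.ofNat_ne_top,
      ENNReal.toReal_ofNat, ← ENNReal.rpow_mul]
    norm_num
  rw [this]
  refine lintegral_mono_ae ?_
  filter_upwards [ae_memLp_slice hf] with y hy
  rw [← ENNReal.mul_rpow_of_nonneg _ _ (by norm_num)]
  exact ENNReal.rpow_le_rpow (enorm_sliceCoeff_le φ hy) (by norm_num)

theorem memLp_sliceCoeff [SFinite μ] [SFinite ν] (φ : Lp ℂ 2 μ)
    {f : ℝ × ℝ → ℂ} (hf : MemLp f 2 (μ.prod ν)) : MemLp (sliceCoeff φ f) 2 ν :=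
  ⟨aestronglyMeasurable_sliceCoeff φ hf.1, (eLpNorm_sliceCoeff_le φ hf).trans_lt
    (ENNReal.mul_lt_top (Lp.memLp φ).2 hf.2)⟩

/-- One summand of the partial integral with degenerate kernel. -/
def degenerateTerm (φ : Lp ℂ 2 μ) (h : Lp ℝ ∞ ν) (f : ℝ × ℝ → ℂ) : ℝ × ℝ → ℂ :=
  fun z => φ z.1 * ((h z.2 : ℂ) * sliceCoeff φ f z.2)

theorem memLp_ofReal_top (h : Lp ℝ ∞ ν) : MemLp (fun y => (h y : ℂ)) ∞ ν :=
  (Lp.memLp h).ofReal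

theorem eLpNorm_degenerateTerm_le [SFinite μ] [SFinite ν] (φ : Lp ℂ 2 μ) (h : Lp ℝ ∞ ν)
    {f : ℝ × ℝ → ℂ} (hf : MemLp f 2 (μ.prod ν)) :
    eLpNorm (degenerateTerm φ h f) 2 (μ.prod ν) ≤
      eLpNorm φ 2 μ * (eLpNorm (fun y => (h y : ℂ)) ∞ ν * eLpNorm φ 2 μ) *
        eLpNorm f 2 (μ.prod ν) := by
  have hs := memLp_sliceCoeff φ hf
  have he := eLpNorm_two_prod_mul (Lp.memLp φ).1 ((memLp_ofReal_top h).1.mul hs.1)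
  simp only [Pi.mul_apply] at he
  unfold degenerateTerm
  rw [he, mul_assoc, mul_assoc]
  gcongr
  exact (eLpNorm_smul_le_mul_eLpNorm (p := ∞) hs.1 (memLp_ofReal_top h).1).trans
    (by gcongr; exact eLpNorm_sliceCoeff_le φ hf)

theorem memLp_degenerateTerm [SFinite μ] [SFinite ν] (φ : Lp ℂ 2 μ) (h : Lp ℝ ∞ ν)
    {f : ℝ × ℝ → ℂ} (hf : MemLp f 2 (μ.prod ν)) :
    MemLp (degenerateTerm φ h f) 2 (μ.prod ν) := by
  refine ⟨?_, (eLpNorm_degenerateTerm_le φ h hf).trans_lt ?_⟩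
  · exact (Lp.memLp φ).1.comp_fst.mul
      (((memLp_ofReal_top h).1.mul (memLp_sliceCoeff φ hf).1).comp_snd)
  · exact ENNReal.mul_lt_top (ENNReal.mul_lt_top (Lp.memLp φ).2
      (ENNReal.mul_lt_top (memLp_ofReal_top h).2 (Lp.memLp φ).2)) hf.2

theorem ae_prod_snd [SFinite μ] [SFinite ν] {P : ℝ → Prop} (h : ∀ᵐ y ∂ν, P y) :
    ∀ᵐ z ∂(μ.prod ν), P z.2 :=
  Measure.quasiMeasurePreserving_snd.ae h

theorem ae_ae_slice [SFinite μ] [SFinite ν] {P : ℝ × ℝ → Prop} (h : ∀ᵐ z ∂(μ.prod ν), P z) :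
    ∀ᵐ y ∂ν, ∀ᵐ s ∂μ, P (s, y) := by
  have := (Measure.measurePreserving_swap (μ := ν) (ν := μ)).quasiMeasurePreserving.ae h
  exact Measure.ae_ae_of_ae_prod this

theorem partialInt₁_ae_eq_sum [SFinite μ] [SFinite ν] {n : ℕ} (φ : Fin n → Lp ℂ 2 μ)
    (h : Fin n → Lp ℝ ∞ ν) {f : ℝ × ℝ → ℂ} (hf : MemLp f 2 (μ.prod ν)) :
    partialInt₁ μ (degenerateKernel₁ φ h) f =ᵐ[μ.prod ν]
      fun z => ∑ i, degenerateTerm (φ i) (h i) f z := by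
  filter_upwards [ae_prod_snd (μ := μ) (ae_memLp_slice hf)] with z hz
  have hi : ∀ i, Integrable (fun s => conj (φ i s) * f (s, z.2)) μ := fun i =>
    memLp_one_iff_integrable.1 (hz.mul' (memLp_conj (φ i)))
  simp only [partialInt₁, degenerateKernel₁, degenerateTerm, sliceCoeff, Finset.sum_mul]
  have he : ∀ i s, φ i z.1 * conj (φ i s) * (h i z.2 : ℂ) * f (s, z.2) =
      φ i z.1 * (h i z.2 : ℂ) * (conj (φ i s) * f (s, z.2)) := fun i s => by ring
  simp only [he]
  rw [integral_finsetSum _ fun i _ => (hi i).const_mul _]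
  refine Finset.sum_congr rfl fun i _ => ?_
  rw [integral_const_mul, mul_assoc]

theorem memLp_partialInt₁ [SFinite μ] [SFinite ν] {n : ℕ} (φ : Fin n → Lp ℂ 2 μ)
    (h : Fin n → Lp ℝ ∞ ν) {f : ℝ × ℝ → ℂ} (hf : MemLp f 2 (μ.prod ν)) :
    MemLp (partialInt₁ μ (degenerateKernel₁ φ h) f) 2 (μ.prod ν) :=
  (memLp_finsetSum _ fun i _ => memLp_degenerateTerm (φ i) (h i) hf).ae_eq
    (partialInt₁_ae_eq_sum φ h hf).symm

theorem exists_eLpNorm_partialInt₁_le [SFinite μ] [SFinite ν] {n : ℕ} (φ : Fin n → Lp ℂ 2 μ)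
    (h : Fin n → Lp ℝ ∞ ν) : ∃ C : ℝ≥0∞, C ≠ ∞ ∧ ∀ f : ℝ × ℝ → ℂ, MemLp f 2 (μ.prod ν) →
      eLpNorm (partialInt₁ μ (degenerateKernel₁ φ h) f) 2 (μ.prod ν) ≤
        C * eLpNorm f 2 (μ.prod ν) := by
  refine ⟨∑ i, eLpNorm (φ i) 2 μ * (eLpNorm (fun y => (h i y : ℂ)) ∞ ν * eLpNorm (φ i) 2 μ),
    ?_, fun f hf => ?_⟩
  · exact ENNReal.sum_ne_top.2 fun i _ => (ENNReal.mul_lt_top (Lp.memLp (φ i)).2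
      (ENNReal.mul_lt_top (memLp_ofReal_top (h i)).2 (Lp.memLp (φ i)).2)).ne
  · rw [eLpNorm_congr_ae (partialInt₁_ae_eq_sum φ h hf), Finset.sum_mul]
    have := eLpNorm_sum_le (μ := μ.prod ν) (p := 2) (s := Finset.univ)
      (f := fun i => degenerateTerm (φ i) (h i) f)
      (fun i _ => (memLp_degenerateTerm (φ i) (h i) hf).1) (by norm_num)
    refine le_trans (le_of_eq ?_) (this.trans (Finset.sum_le_sum fun i _ =>
      eLpNorm_degenerateTerm_le (φ i) (h i) hf))
    congr 1
    ext z
    simp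

theorem partialInt₁_congr [SFinite μ] [SFinite ν] (k : ℝ → ℝ → ℝ → ℂ) {f g : ℝ × ℝ → ℂ}
    (hfg : f =ᵐ[μ.prod ν] g) : partialInt₁ μ k f =ᵐ[μ.prod ν] partialInt₁ μ k g := by
  filter_upwards [ae_prod_snd (μ := μ) (ae_ae_slice hfg)] with z hz
  refine integral_congr_ae ?_
  filter_upwards [hz] with s hs
  rw [hs]

theorem partialInt₁_add [SFinite μ] [SFinite ν] {n : ℕ} (φ : Fin n → Lp ℂ 2 μ)
    (h : Fin n → Lp ℝ ∞ ν) {f g : ℝ × ℝ → ℂ} (hf : MemLp f 2 (μ.prod ν))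
    (hg : MemLp g 2 (μ.prod ν)) :
    partialInt₁ μ (degenerateKernel₁ φ h) (f + g) =ᵐ[μ.prod ν]
      partialInt₁ μ (degenerateKernel₁ φ h) f + partialInt₁ μ (degenerateKernel₁ φ h) g := by
  filter_upwards [partialInt₁_ae_eq_sum φ h hf, partialInt₁_ae_eq_sum φ h hg,
    partialInt₁_ae_eq_sum φ h (hf.add hg), ae_prod_snd (μ := μ) (ae_memLp_slice hf),
    ae_prod_snd (μ := μ) (ae_memLp_slice hg)] with z h1 h2 h3 h4 h5
  rw [h3, Pi.add_apply, h1, h2, ← Finset.sum_add_distrib]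
  refine Finset.sum_congr rfl fun i _ => ?_
  have : sliceCoeff (φ i) (f + g) z.2 = sliceCoeff (φ i) f z.2 + sliceCoeff (φ i) g z.2 := by
    simp only [sliceCoeff, Pi.add_apply, mul_add]
    exact integral_add (memLp_one_iff_integrable.1 (h4.mul' (memLp_conj (φ i))))
      (memLp_one_iff_integrable.1 (h5.mul' (memLp_conj (φ i))))
  simp only [degenerateTerm, this]
  ring

theorem partialInt₁_smul (k : ℝ → ℝ → ℝ → ℂ) (a : ℂ) (f : ℝ × ℝ → ℂ) :
    partialInt₁ μ k (a • f) = a • partialInt₁ μ k f := by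
  ext z
  simp only [partialInt₁, Pi.smul_apply, smul_eq_mul, mul_left_comm _ a]
  exact integral_const_mul _ _

/-- Exchanging the two variables turns the second type of partial integral into the first. -/
theorem partialInt₂_eq_swap {m : ℕ} (p : Fin m → Lp ℝ ∞ μ) (ψ : Fin m → Lp ℂ 2 ν)
    (f : ℝ × ℝ → ℂ) :
    partialInt₂ ν (degenerateKernel₂ p ψ) f =
      partialInt₁ ν (degenerateKernel₁ ψ p) (f ∘ Prod.swap) ∘ Prod.swap := by
  ext z
  simp only [partialInt₂, partialInt₁, degenerateKernel₁, degenerateKernel₂, Function.comp,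
    Prod.swap]
  refine integral_congr_ae (Filter.Eventually.of_forall fun t => ?_)
  simp only
  congr 1
  exact Finset.sum_congr rfl fun i _ => by ring

theorem memLp_swap [SFinite μ] [SFinite ν] {f : ℝ × ℝ → ℂ} (hf : MemLp f 2 (μ.prod ν)) :
    MemLp (f ∘ Prod.swap) 2 (ν.prod μ) :=
  hf.comp_measurePreserving Measure.measurePreserving_swap

theorem memLp_partialInt₂ [SFinite μ] [SFinite ν] {m : ℕ} (p : Fin m → Lp ℝ ∞ μ)
    (ψ : Fin m → Lp ℂ 2 ν) {f : ℝ × ℝ → ℂ} (hf : MemLp f 2 (μ.prod ν)) :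
    MemLp (partialInt₂ ν (degenerateKernel₂ p ψ) f) 2 (μ.prod ν) := by
  rw [partialInt₂_eq_swap]
  exact memLp_swap (memLp_partialInt₁ ψ p (memLp_swap hf))

theorem partialInt₂_congr [SFinite μ] [SFinite ν] (k : ℝ → ℝ → ℝ → ℂ) {f g : ℝ × ℝ → ℂ}
    (hfg : f =ᵐ[μ.prod ν] g) : partialInt₂ ν k f =ᵐ[μ.prod ν] partialInt₂ ν k g := by
  have h1 : ∀ᵐ x ∂μ, ∀ᵐ t ∂ν, f (x, t) = g (x, t) := Measure.ae_ae_of_ae_prod hfg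
  filter_upwards [Measure.quasiMeasurePreserving_fst.ae h1] with z hz
  refine integral_congr_ae ?_
  filter_upwards [hz] with t ht
  rw [ht]

theorem partialInt₂_add [SFinite μ] [SFinite ν] {m : ℕ} (p : Fin m → Lp ℝ ∞ μ)
    (ψ : Fin m → Lp ℂ 2 ν) {f g : ℝ × ℝ → ℂ} (hf : MemLp f 2 (μ.prod ν))
    (hg : MemLp g 2 (μ.prod ν)) :
    partialInt₂ ν (degenerateKernel₂ p ψ) (f + g) =ᵐ[μ.prod ν]
      partialInt₂ ν (degenerateKernel₂ p ψ) f + partialInt₂ ν (degenerateKernel₂ p ψ) g := by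
  simp only [partialInt₂_eq_swap]
  exact (Measure.measurePreserving_swap (μ := μ) (ν := ν)).quasiMeasurePreserving.ae_eq_comp
    (partialInt₁_add ψ p (memLp_swap hf) (memLp_swap hg))

theorem partialInt₂_smul (k : ℝ → ℝ → ℝ → ℂ) (a : ℂ) (f : ℝ × ℝ → ℂ) :
    partialInt₂ ν k (a • f) = a • partialInt₂ ν k f := by
  ext z
  simp only [partialInt₂, Pi.smul_apply, smul_eq_mul, mul_left_comm _ a]
  exact integral_const_mul _ _

theorem exists_eLpNorm_partialInt₂_le [SFinite μ] [SFinite ν] {m : ℕ} (p : Fin m → Lp ℝ ∞ μ)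
    (ψ : Fin m → Lp ℂ 2 ν) : ∃ C : ℝ≥0∞, C ≠ ∞ ∧ ∀ f : ℝ × ℝ → ℂ, MemLp f 2 (μ.prod ν) →
      eLpNorm (partialInt₂ ν (degenerateKernel₂ p ψ) f) 2 (μ.prod ν) ≤
        C * eLpNorm f 2 (μ.prod ν) := by
  obtain ⟨C, hC, h⟩ := exists_eLpNorm_partialInt₁_le ψ p
  refine ⟨C, hC, fun f hf => ?_⟩
  have hg := memLp_swap hf
  rw [partialInt₂_eq_swap, eLpNorm_comp_measurePreserving (memLp_partialInt₁ ψ p hg).1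
    Measure.measurePreserving_swap]
  refine (h _ hg).trans (le_of_eq ?_)
  rw [eLpNorm_comp_measurePreserving hf.1 Measure.measurePreserving_swap]

/-- The partial integral operator `T₁` on `L²` with kernel `∑ᵢ φᵢ(x) conj(φᵢ(s)) hᵢ(y)`:
`(T₁ f)(x, y) = ∫ k₁(x, s, y) f(s, y) dμ(s)`. -/
def partialIntegralOp₁ [SFinite μ] [SFinite ν] {n : ℕ} (φ : Fin n → Lp ℂ 2 μ)
    (h : Fin n → Lp ℝ ∞ ν) : Lp ℂ 2 (μ.prod ν) →L[ℂ] Lp ℂ 2 (μ.prod ν) :=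
  LinearMap.mkContinuousOfExistsBound
    { toFun := fun f => (memLp_partialInt₁ φ h (Lp.memLp f)).toLp
        (partialInt₁ μ (degenerateKernel₁ φ h) f)
      map_add' := fun f g => by
        rw [← MemLp.toLp_add]
        exact MemLp.toLp_congr _ _ ((partialInt₁_congr _ (Lp.coeFn_add f g)).trans
          (partialInt₁_add φ h (Lp.memLp f) (Lp.memLp g)))
      map_smul' := fun a f => by
        rw [RingHom.id_apply, ← MemLp.toLp_const_smul]
        exact MemLp.toLp_congr _ _ ((partialInt₁_congr _ (Lp.coeFn_smul a f)).trans
          (Filter.EventuallyEq.of_eq (partialInt₁_smul _ a f))) }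
    (by
      obtain ⟨C, hC, hb⟩ := exists_eLpNorm_partialInt₁_le φ h
      refine ⟨C.toReal, fun f => ?_⟩
      simp only [LinearMap.coe_mk, AddHom.coe_mk]
      rw [Lp.norm_toLp, Lp.norm_def, ← ENNReal.toReal_mul]
      exact ENNReal.toReal_mono (ENNReal.mul_ne_top hC (Lp.memLp f).2.ne) (hb f (Lp.memLp f)))

/-- The partial integral operator `T₂` on `L²` with kernel `∑ⱼ pⱼ(x) ψⱼ(y) conj(ψⱼ(t))`:
`(T₂ f)(x, y) = ∫ k₂(x, t, y) f(x, t) dν(t)`. -/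
def partialIntegralOp₂ [SFinite μ] [SFinite ν] {m : ℕ} (p : Fin m → Lp ℝ ∞ μ)
    (ψ : Fin m → Lp ℂ 2 ν) : Lp ℂ 2 (μ.prod ν) →L[ℂ] Lp ℂ 2 (μ.prod ν) :=
  LinearMap.mkContinuousOfExistsBound
    { toFun := fun f => (memLp_partialInt₂ p ψ (Lp.memLp f)).toLp
        (partialInt₂ ν (degenerateKernel₂ p ψ) f)
      map_add' := fun f g => by
        rw [← MemLp.toLp_add]
        exact MemLp.toLp_congr _ _ ((partialInt₂_congr _ (Lp.coeFn_add f g)).trans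
          (partialInt₂_add p ψ (Lp.memLp f) (Lp.memLp g)))
      map_smul' := fun a f => by
        rw [RingHom.id_apply, ← MemLp.toLp_const_smul]
        exact MemLp.toLp_congr _ _ ((partialInt₂_congr _ (Lp.coeFn_smul a f)).trans
          (Filter.EventuallyEq.of_eq (partialInt₂_smul _ a f))) }
    (by
      obtain ⟨C, hC, hb⟩ := exists_eLpNorm_partialInt₂_le p ψ
      refine ⟨C.toReal, fun f => ?_⟩
      simp only [LinearMap.coe_mk, AddHom.coe_mk]
      rw [Lp.norm_toLp, Lp.norm_def, ← ENNReal.toReal_mul]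
      exact ENNReal.toReal_mono (ENNReal.mul_ne_top hC (Lp.memLp f).2.ne) (hb f (Lp.memLp f)))

theorem partialIntegralOp₁_ae_eq [SFinite μ] [SFinite ν] {n : ℕ} (φ : Fin n → Lp ℂ 2 μ)
    (h : Fin n → Lp ℝ ∞ ν) (f : Lp ℂ 2 (μ.prod ν)) :
    partialIntegralOp₁ φ h f =ᵐ[μ.prod ν] partialInt₁ μ (degenerateKernel₁ φ h) f :=
  MemLp.coeFn_toLp (memLp_partialInt₁ φ h (Lp.memLp f))

theorem partialIntegralOp₂_ae_eq [SFinite μ] [SFinite ν] {m : ℕ} (p : Fin m → Lp ℝ ∞ μ)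
    (ψ : Fin m → Lp ℂ 2 ν) (f : Lp ℂ 2 (μ.prod ν)) :
    partialIntegralOp₂ p ψ f =ᵐ[μ.prod ν] partialInt₂ ν (degenerateKernel₂ p ψ) f :=
  MemLp.coeFn_toLp (memLp_partialInt₂ p ψ (Lp.memLp f))

end Kernels

end

/-!
For a self-adjoint operator `T`, a point `z` lies outside the essential spectrum exactly when
`T - z` is left invertible modulo compact operators. If `A A'` and `A' A` are compact, then modulo
compact operators `(A - z) (A' - z) = -z (A + A' - z)`, so for `z ≠ 0` the essential spectrum of a
sum of operators with pairwise compact products is the union of the essential spectra of the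
summands.

The operator `T₁ + T₂` is such a sum: its summands are `J M J†`, where `M` is multiplication by
some `hᵢ` or `pⱼ` and `J` is the isometry `v ↦ φᵢ ⊗ v` or `u ↦ u ⊗ ψⱼ`. Two summands of the same
kind have product zero by orthogonality, and for summands of different kinds `J† J'` has rank one.
On an atomless measure space the essential spectrum of a multiplication operator is the essential
range of the multiplier, because a set of positive measure carries unit vectors concentrating on
arbitrarily small sets. Finally, `0` is in the essential spectrum because `T₁ + T₂` is compact on
the infinite-dimensional space `u ⊗ L²`, where `u` is a unit vector orthogonal to every `φᵢ`.
-/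

open Filter Topology
open scoped InnerProductSpace NNReal

section LeftInvertibleModCompact

variable {𝕜 E : Type*} [NontriviallyNormedField 𝕜] [NormedAddCommGroup E] [NormedSpace 𝕜 E]

/-- Left invertibility of a bounded operator in the Calkin algebra, i.e. modulo compact operators.
It is the one-sided form of the Fredholm property; for self-adjoint operators the two agree. -/
def IsLeftInvertibleModCompact (S : E →L[𝕜] E) : Prop :=
  ∃ B : E →L[𝕜] E, IsCompactOperator (1 - B * S : E →L[𝕜] E)

namespace IsLeftInvertibleModCompact

theorem of_isUnit {S : E →L[𝕜] E} (hS : IsUnit S) : IsLeftInvertibleModCompact S := by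
  obtain ⟨B, hB⟩ := hS.exists_left_inv
  exact ⟨B, by rw [hB, sub_self]; exact isCompactOperator_zero⟩

theorem of_mul {R S : E →L[𝕜] E} (h : IsLeftInvertibleModCompact (R * S)) :
    IsLeftInvertibleModCompact S := by
  obtain ⟨B, hB⟩ := h
  exact ⟨B * R, by rwa [mul_assoc]⟩

theorem mul {R S : E →L[𝕜] E} (hR : IsLeftInvertibleModCompact R)
    (hS : IsLeftInvertibleModCompact S) : IsLeftInvertibleModCompact (R * S) := by
  obtain ⟨A, hA⟩ := hR
  obtain ⟨B, hB⟩ := hS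
  refine ⟨B * A, ?_⟩
  have hsplit : 1 - B * A * (R * S) = (1 - B * S) + B * ((1 - A * R) * S) := by noncomm_ring
  rw [hsplit]
  exact hB.add ((hA.comp_clm S).clm_comp B)

theorem congr {R S : E →L[𝕜] E} (hR : IsLeftInvertibleModCompact R)
    (hRS : IsCompactOperator (R - S)) : IsLeftInvertibleModCompact S := by
  obtain ⟨B, hB⟩ := hR
  refine ⟨B, ?_⟩
  have hsplit : 1 - B * S = (1 - B * R) + B * (R - S) := by noncomm_ring
  rw [hsplit]
  exact hB.add (hRS.clm_comp B)

theorem smul_iff {c : 𝕜} (hc : c ≠ 0) {S : E →L[𝕜] E} :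
    IsLeftInvertibleModCompact (c • S) ↔ IsLeftInvertibleModCompact S := by
  refine ⟨fun h => of_mul (R := c • 1) (by simpa using h), fun ⟨B, hB⟩ => ⟨c⁻¹ • B, ?_⟩⟩
  rwa [smul_mul_smul_comm, inv_mul_cancel₀ hc, one_smul]

theorem add_sub_smul_one_iff {A A' : E →L[𝕜] E} (h : IsCompactOperator (A * A'))
    (h' : IsCompactOperator (A' * A)) {z : 𝕜} (hz : z ≠ 0) :
    IsLeftInvertibleModCompact (A + A' - z • 1) ↔
      IsLeftInvertibleModCompact (A - z • 1) ∧ IsLeftInvertibleModCompact (A' - z • 1) := by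
  have hmul (C C' : E →L[𝕜] E) :
      (C - z • 1) * (C' - z • 1) - -z • (C + C' - z • 1) = C * C' := by
    simp only [sub_mul, mul_sub, smul_sub, smul_add, neg_smul, mul_smul_comm, smul_mul_assoc,
      mul_one, one_mul]
    abel
  have hmul' (C C' : E →L[𝕜] E) :
      -z • (C + C' - z • 1) - (C - z • 1) * (C' - z • 1) = -(C * C') := by
    rw [← hmul C C', neg_sub]
  rw [← smul_iff (neg_ne_zero.2 hz)]
  refine ⟨fun hs => ⟨of_mul (R := A' - z • 1) (hs.congr ?_), of_mul (R := A - z • 1) (hs.congr ?_)⟩,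
    fun ⟨hA, hA'⟩ => (hA.mul hA').congr ?_⟩
  · rw [add_comm A, hmul']
    exact h'.neg
  · rw [hmul']
    exact h.neg
  · rwa [hmul]

theorem sum_sub_smul_one_iff {ι : Type*} {A : ι → E →L[𝕜] E}
    (hA : Pairwise fun i j => IsCompactOperator (A i * A j)) {z : 𝕜} (hz : z ≠ 0) (s : Finset ι) :
    IsLeftInvertibleModCompact (∑ i ∈ s, A i - z • 1) ↔
      ∀ i ∈ s, IsLeftInvertibleModCompact (A i - z • 1) := by
  classical
  induction s using Finset.induction_on with
  | empty =>
    have hunit : IsUnit (-(z • 1) : E →L[𝕜] E) := by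
      simpa only [Algebra.algebraMap_eq_smul_one] using
        ((isUnit_iff_ne_zero.2 hz).map (algebraMap 𝕜 (E →L[𝕜] E))).neg
    simpa using of_isUnit hunit
  | insert i s hi ih =>
    have hne {j : ι} (hj : j ∈ s) : i ≠ j := by rintro rfl; exact hi hj
    have hleft : IsCompactOperator (A i * ∑ j ∈ s, A j) := by
      rw [Finset.mul_sum]
      exact (compactOperator (RingHom.id 𝕜) E E).sum_mem fun j hj => hA (hne hj)
    have hright : IsCompactOperator ((∑ j ∈ s, A j) * A i) := by
      rw [Finset.sum_mul]
      exact (compactOperator (RingHom.id 𝕜) E E).sum_mem fun j hj => hA (hne hj).symm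
    rw [Finset.sum_insert hi, add_sub_smul_one_iff hleft hright hz, ih, Finset.forall_mem_insert]

/-- The conjugate `J M P` lives on a possibly larger space, where it acts as `0` off the range
of `J`; there `-z • 1` is invertible. -/
theorem conj_sub_smul_one_iff {F : Type*} [NormedAddCommGroup F] [NormedSpace 𝕜 F] {J : E →L[𝕜] F}
    {P : F →L[𝕜] E} (hPJ : P ∘L J = 1) (M : E →L[𝕜] E) {z : 𝕜} (hz : z ≠ 0) :
    IsLeftInvertibleModCompact (J ∘L M ∘L P - z • 1) ↔ IsLeftInvertibleModCompact (M - z • 1) := by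
  have hPJ' (x : E) : P (J x) = x := DFunLike.congr_fun hPJ x
  constructor
  · rintro ⟨B, hB⟩
    refine ⟨P ∘L B ∘L J, ?_⟩
    have hcompress : 1 - (P ∘L B ∘L J) * (M - z • 1) =
        P ∘L (1 - B * (J ∘L M ∘L P - z • 1)) ∘L J := by
      ext x
      simp [hPJ']
    rw [hcompress]
    exact (hB.comp_clm J).clm_comp P
  · rintro ⟨B, hB⟩
    refine ⟨J ∘L B ∘L P - z⁻¹ • (1 - J ∘L P), ?_⟩
    have hdilate : 1 - (J ∘L B ∘L P - z⁻¹ • (1 - J ∘L P)) * (J ∘L M ∘L P - z • 1) =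
        J ∘L (1 - B * (M - z • 1)) ∘L P := by
      ext x
      simp only [sub_apply, one_apply_eq_self, mul_apply_eq_comp, smul_apply, map_sub, map_smul,
        ContinuousLinearMap.comp_apply, ContinuousLinearMap.sub_comp, ContinuousLinearMap.comp_sub,
        hPJ', smul_sub, smul_inv_smul₀ hz]
      abel
    rw [hdilate]
    exact (hB.comp_clm P).clm_comp J

theorem exists_tendsto_subseq {S : E →L[𝕜] E} (hS : IsLeftInvertibleModCompact S) {x : ℕ → E}
    (hx : ∀ k, ‖x k‖ ≤ 1) (hSx : Tendsto (fun k => S (x k)) atTop (𝓝 0)) :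
    ∃ y, ∃ ψ : ℕ → ℕ, StrictMono ψ ∧ Tendsto (x ∘ ψ) atTop (𝓝 y) := by
  obtain ⟨B, hB⟩ := hS
  obtain ⟨C, hC, hsub⟩ := hB.image_closedBall_subset_compact (𝕜₁ := 𝕜)
    (f := ((1 - B * S : E →L[𝕜] E) : E →ₗ[𝕜] E)) 1
  obtain ⟨y, -, ψ, hψ, hy⟩ := hC.tendsto_subseq (x := fun k => (1 - B * S) (x k)) fun k =>
    hsub ⟨x k, by simpa using hx k, rfl⟩
  refine ⟨y, ψ, hψ, ?_⟩
  have hBS : Tendsto (fun k => B (S (x (ψ k)))) atTop (𝓝 0) := by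
    simpa [Function.comp_def] using ((B.continuous.tendsto 0).comp hSx).comp hψ.tendsto_atTop
  simpa [Function.comp_def] using hy.add hBS

theorem finiteDimensional_ker [CompleteSpace 𝕜] {S : E →L[𝕜] E}
    (hS : IsLeftInvertibleModCompact S) :
    FiniteDimensional 𝕜 (LinearMap.ker (S : E →ₗ[𝕜] E)) := by
  obtain ⟨B, hB⟩ := hS
  let K : E →ₗ[𝕜] E := ((1 - B * S : E →L[𝕜] E) : E →ₗ[𝕜] E)
  have hK {x : E} (hx : x ∈ LinearMap.ker (S : E →ₗ[𝕜] E)) : K x = x := by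
    have hSx : S x = 0 := hx
    simp [K, hSx]
  have hmaps : ∀ x ∈ LinearMap.ker (S : E →ₗ[𝕜] E), K x ∈ LinearMap.ker (S : E →ₗ[𝕜] E) :=
    fun x hx => by rwa [hK hx]
  have hid : IsCompactOperator (K.restrict hmaps) :=
    IsCompactOperator.restrict (f := K) hB hmaps S.isClosed_ker
  have hrestrict : ⇑(K.restrict hmaps) = id := funext fun x => Subtype.ext (hK x.2)
  rw [hrestrict] at hid
  exact FiniteDimensional.of_isCompactOperator_id (𝕜 := 𝕜) hid

end IsLeftInvertibleModCompact

theorem not_isLeftInvertibleModCompact_of_comp {F : Type*} [NormedAddCommGroup F] [NormedSpace 𝕜 F]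
    [CompleteSpace 𝕜] (hE : ¬ FiniteDimensional 𝕜 E) {V : E →L[𝕜] F} {P : F →L[𝕜] E}
    (hPV : P ∘L V = 1) {T : F →L[𝕜] F} (hTV : IsCompactOperator (T ∘L V)) :
    ¬ IsLeftInvertibleModCompact T := by
  rintro ⟨B, hB⟩
  refine hE (FiniteDimensional.of_isCompactOperator_id (𝕜 := 𝕜) ?_)
  have hPV' (x : E) : P (V x) = x := DFunLike.congr_fun hPV x
  have hsplit : (1 : E →L[𝕜] E) = P ∘L (1 - B * T) ∘L V + (P ∘L B) ∘L (T ∘L V) := by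
    ext x
    simp [hPV']
  have h1 : IsCompactOperator (1 : E →L[𝕜] E) := by
    rw [hsplit]
    exact ((hB.comp_clm V).clm_comp P).add (hTV.clm_comp (P ∘L B))
  exact h1

end LeftInvertibleModCompact

section SelfAdjoint

theorem isCompactOperator_of_forall_mem {𝕜 E F : Type*} [NontriviallyNormedField 𝕜]
    [ProperSpace 𝕜] [NormedAddCommGroup E] [NormedSpace 𝕜 E] [NormedAddCommGroup F]
    [NormedSpace 𝕜 F] {N : Submodule 𝕜 F} [FiniteDimensional 𝕜 N] {Q : E →L[𝕜] F}
    (hQ : ∀ x, Q x ∈ N) : IsCompactOperator Q := by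
  have : ProperSpace N := FiniteDimensional.proper 𝕜 N
  exact (isCompactOperator_of_locallyCompactSpace_dom (Q.codRestrict N hQ)).clm_comp N.subtypeL

theorem IsLeftInvertibleModCompact.exists_antilipschitzWith {𝕜 E : Type*} [RCLike 𝕜]
    [NormedAddCommGroup E] [NormedSpace 𝕜 E] {S : E →L[𝕜] E} (hS : IsLeftInvertibleModCompact S)
    (hinj : Function.Injective S) : ∃ c, AntilipschitzWith c S := by
  rw [antilipschitzWith_iff_exists_mul_le_norm]
  by_contra! hsmall
  choose x hx using fun k : ℕ => hsmall (1 / (k + 1)) Nat.one_div_pos_of_nat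
  have hx0 (k : ℕ) : ‖x k‖ ≠ 0 := fun h0 => by
    simpa [h0] using (norm_nonneg _).trans_lt (hx k)
  let u (k : ℕ) : E := ((‖x k‖⁻¹ : ℝ) : 𝕜) • x k
  have hu (k : ℕ) : ‖u k‖ = 1 := by simp [u, norm_smul, inv_mul_cancel₀ (hx0 k)]
  have hSu : Tendsto (fun k => S (u k)) atTop (𝓝 0) := by
    refine squeeze_zero_norm (fun k => ?_) tendsto_one_div_add_atTop_nhds_zero_nat
    have hpos : 0 < ‖x k‖ := (norm_nonneg _).lt_of_ne' (hx0 k)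
    calc ‖S (u k)‖ = ‖x k‖⁻¹ * ‖S (x k)‖ := by simp [u, norm_smul]
      _ ≤ 1 / (k + 1) := by
        rw [inv_mul_le_iff₀ hpos, mul_comm]
        exact (hx k).le
  obtain ⟨y, ψ, hψ, hy⟩ := hS.exists_tendsto_subseq (fun k => (hu k).le) hSu
  have hSy : S y = 0 :=
    tendsto_nhds_unique ((S.continuous.tendsto y).comp hy) (hSu.comp hψ.tendsto_atTop)
  have hy1 : ‖y‖ = 1 :=
    tendsto_nhds_unique hy.norm (by simp [hu])
  rw [hinj (hSy.trans (map_zero S).symm), norm_zero] at hy1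
  exact zero_ne_one hy1

variable {𝕜 H : Type*} [RCLike 𝕜] [NormedAddCommGroup H] [InnerProductSpace 𝕜 H] [CompleteSpace H]

theorem isUnit_of_antilipschitzWith {S : H →L[𝕜] H} (hsa : IsSelfAdjoint S) {c : ℝ≥0}
    (hS : AntilipschitzWith c S) : IsUnit S := by
  rw [ContinuousLinearMap.isUnit_iff_bijective,
    ContinuousLinearMap.bijective_iff_dense_range_and_antilipschitz]
  refine ⟨?_, c, hS⟩
  rw [Submodule.topologicalClosure_eq_top_iff, S.orthogonal_range, hsa.adjoint_eq,
    LinearMap.ker_eq_bot]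
  exact hS.injective

theorem IsLeftInvertibleModCompact.isUnit_of_isSelfAdjoint {S : H →L[𝕜] H}
    (hS : IsLeftInvertibleModCompact S) (hsa : IsSelfAdjoint S) (hinj : Function.Injective S) :
    IsUnit S :=
  let ⟨_, hc⟩ := hS.exists_antilipschitzWith hinj
  isUnit_of_antilipschitzWith hsa hc

theorem IsLeftInvertibleModCompact.isUnit_add_starProjection_ker {S : H →L[𝕜] H}
    (hS : IsLeftInvertibleModCompact S) (hsa : IsSelfAdjoint S) :
    IsUnit (S + S.ker.starProjection) := by
  have := hS.finiteDimensional_ker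
  have hP : IsCompactOperator (S - (S + S.ker.starProjection)) := by
    rw [sub_add_cancel_left]
    exact (isCompactOperator_of_forall_mem S.ker.starProjection_apply_mem).neg
  refine (hS.congr hP).isUnit_of_isSelfAdjoint
    (hsa.add (isSelfAdjoint_starProjection _)) ?_
  rw [injective_iff_map_eq_zero]
  intro x hx
  have hSx_ker : S x ∈ S.ker := by
    rw [show S x = -S.ker.starProjection x from eq_neg_of_add_eq_zero_left hx]
    exact neg_mem (S.ker.starProjection_apply_mem x)
  have hSx : S x = 0 := by
    rw [← inner_self_eq_zero (𝕜 := 𝕜), ← ContinuousLinearMap.adjoint_inner_right, hsa.adjoint_eq,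
      show S (S x) = 0 from hSx_ker, inner_zero_right]
  simpa [hSx, S.ker.starProjection_eq_self_iff.2 hSx] using hx

theorem eventually_isUnit_sub_smul_one {𝕜 R : Type*} [NormedField 𝕜] [NormedRing R]
    [NormedAlgebra 𝕜 R] [CompleteSpace R] {S P : R} (hSP : S * P = 0) (hPS : P * S = 0)
    (hunit : IsUnit (S + P)) :
    ∀ᶠ δ : 𝕜 in 𝓝[≠] 0, IsUnit (S - δ • 1) := by
  have hnear : ∀ᶠ δ : 𝕜 in 𝓝 0, IsUnit (S + P - δ • 1) := by
    have hcont : Continuous fun δ : 𝕜 => S + P - δ • (1 : R) := by fun_prop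
    exact hcont.continuousAt.eventually_mem (Units.isOpen.mem_nhds (by simpa using hunit))
  filter_upwards [nhdsWithin_le_nhds hnear, self_mem_nhdsWithin] with δ hδ hδ0
  have hfactor : (S - δ • 1) * (1 - δ⁻¹ • P) = S + P - δ • 1 := by
    simp only [sub_mul, mul_sub, mul_one, one_mul, mul_smul_comm, smul_mul_assoc, hSP, smul_sub,
      smul_zero, inv_smul_smul₀ hδ0]
    abel
  have hfactor' : (1 - δ⁻¹ • P) * (S - δ • 1) = S + P - δ • 1 := by
    simp only [sub_mul, mul_sub, mul_one, one_mul, mul_smul_comm, smul_mul_assoc, hPS, smul_sub,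
      smul_zero, smul_inv_smul₀ hδ0]
    abel
  have hcomm : Commute (S - δ • 1) (1 - δ⁻¹ • P) := hfactor.trans hfactor'.symm
  exact (hcomm.isUnit_mul_iff.1 (hfactor ▸ hδ)).1

end SelfAdjoint

section EssentialSpectrum

variable {H : Type*} [NormedAddCommGroup H] [InnerProductSpace ℂ H]

theorem mem_spectrum_iff_not_isUnit_sub {T : H →L[ℂ] H} {z : ℂ} :
    z ∈ spectrum ℂ T ↔ ¬ IsUnit (T - z • 1) := by
  rw [spectrum.mem_iff, ← IsUnit.neg_iff, neg_sub, Algebra.algebraMap_eq_smul_one]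

theorem eigenspace_eq_ker_sub (T : H →L[ℂ] H) (z : ℂ) :
    Module.End.eigenspace (T : Module.End ℂ H) z = (T - z • 1).ker := by
  ext x
  simp [sub_eq_zero]

variable [CompleteSpace H]

theorem isSelfAdjoint_sub_smul_one_of_mem_spectrum {T : H →L[ℂ] H} (hT : IsSelfAdjoint T) {z : ℂ}
    (hz : z ∈ spectrum ℂ T) : IsSelfAdjoint (T - z • 1) := by
  rw [hT.mem_spectrum_eq_re hz]
  exact hT.sub (IsSelfAdjoint.smul (by simp [isSelfAdjoint_iff]) (.one _))

theorem IsLeftInvertibleModCompact.notMem_essentialSpectrum {T : H →L[ℂ] H} (hT : IsSelfAdjoint T)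
    {z : ℂ} (hS : IsLeftInvertibleModCompact (T - z • 1)) : z ∉ essentialSpectrum T := by
  rintro ⟨hz, hdiscrete⟩
  set S := T - z • (1 : H →L[ℂ] H) with hSdef
  have hsa : IsSelfAdjoint S := isSelfAdjoint_sub_smul_one_of_mem_spectrum hT hz
  have hfin : FiniteDimensional ℂ S.ker := hS.finiteDimensional_ker
  have hunit := hS.isUnit_add_starProjection_ker hsa
  have hSP : S * S.ker.starProjection = 0 := ContinuousLinearMap.ext fun x =>
    S.ker.starProjection_apply_mem x
  have hPS : S.ker.starProjection * S = 0 := by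
    simpa [star_mul, hsa.star_eq, (isSelfAdjoint_starProjection _).star_eq] using congrArg star hSP
  refine hdiscrete ⟨?_, ?_, by rwa [eigenspace_eq_ker_sub]⟩
  · have hres := eventually_isUnit_sub_smul_one (𝕜 := ℂ) hSP hPS hunit
    rw [eventually_nhdsWithin_iff, Metric.eventually_nhds_iff] at hres
    obtain ⟨ε, hε, hres⟩ := hres
    refine ⟨ε, hε, fun w hw hwz => ?_⟩
    by_contra hne
    refine mem_spectrum_iff_not_isUnit_sub.1 hw ?_
    have hunit_w := hres (y := w - z) (by simpa [dist_eq_norm] using hwz) (sub_ne_zero.2 hne)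
    rwa [hSdef, sub_smul, sub_sub, add_sub_cancel] at hunit_w
  · rw [Module.End.hasEigenvalue_iff, eigenspace_eq_ker_sub]
    intro hker
    exact mem_spectrum_iff_not_isUnit_sub.1 hz
      (hS.isUnit_of_isSelfAdjoint hsa (LinearMap.ker_eq_bot.1 hker))

theorem continuousOn_of_continuousOn_compl_singleton {X Y : Type*} [MetricSpace X]
    [TopologicalSpace Y] {s : Set X} {z : X} {ε : ℝ} (hε : 0 < ε)
    (hs : ∀ w ∈ s, dist w z < ε → w = z) {f : X → Y} (hf : ContinuousOn f {z}ᶜ) :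
    ContinuousOn f s := by
  intro w _
  by_cases hwz : w = z
  · subst hwz
    refine tendsto_const_nhds.congr' ?_
    filter_upwards [self_mem_nhdsWithin, mem_nhdsWithin_of_mem_nhds (Metric.ball_mem_nhds w hε)]
      with v hv hvb
    rw [hs v hv hvb]
  · exact (hf.continuousAt (isOpen_compl_singleton.mem_nhds hwz)).continuousWithinAt

theorem exists_mul_mul_eq_self_of_isolated {T : H →L[ℂ] H} [IsStarNormal T] {z : ℂ} {ε : ℝ}
    (hε : 0 < ε) (hz : ∀ w ∈ spectrum ℂ T, dist w z < ε → w = z) :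
    ∃ G : H →L[ℂ] H, (T - z • 1) * G * (T - z • 1) = T - z • 1 := by
  have hS : T - z • 1 = cfc (fun w => w - z) T := by
    rw [cfc_sub _ _ T, cfc_id' ℂ T, cfc_const z T, Algebra.algebraMap_eq_smul_one]
  have hG : ContinuousOn (fun w : ℂ => (w - z)⁻¹) (spectrum ℂ T) :=
    continuousOn_of_continuousOn_compl_singleton hε hz
      (ContinuousOn.inv₀ (by fun_prop) fun w hw => sub_ne_zero.2 hw)
  -- Since `0⁻¹ = 0`, the function `w ↦ (w - z)⁻¹` is defined and continuous also at the isolated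
  -- point `z` of the spectrum.
  refine ⟨cfc (fun w => (w - z)⁻¹) T, ?_⟩
  rw [hS, ← cfc_mul _ _ T (by fun_prop) hG, ← cfc_mul (fun w => (w - z) * (w - z)⁻¹) _ T
    (ContinuousOn.mul (by fun_prop) hG)]
  simp only [mul_inv_mul_cancel]

theorem isLeftInvertibleModCompact_of_mem_discreteSpectrum {T : H →L[ℂ] H} [IsStarNormal T]
    {z : ℂ} (hz : z ∈ discreteSpectrum T) : IsLeftInvertibleModCompact (T - z • 1) := by
  obtain ⟨⟨ε, hε, hisolated⟩, -, hfin⟩ := hz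
  rw [eigenspace_eq_ker_sub] at hfin
  obtain ⟨G, hG⟩ := exists_mul_mul_eq_self_of_isolated hε hisolated
  refine ⟨G, isCompactOperator_of_forall_mem (N := (T - z • 1).ker) fun x => ?_⟩
  have hker : (T - z • 1) * (1 - G * (T - z • 1)) = 0 := by
    rw [mul_sub, mul_one, ← mul_assoc, hG, sub_self]
  exact DFunLike.congr_fun hker x

theorem mem_essentialSpectrum_iff {T : H →L[ℂ] H} (hT : IsSelfAdjoint T) {z : ℂ} :
    z ∈ essentialSpectrum T ↔ ¬ IsLeftInvertibleModCompact (T - z • 1) := by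
  have := hT.isStarNormal
  refine ⟨fun hz hS => hS.notMem_essentialSpectrum hT hz, fun hS => ⟨?_, fun hz => ?_⟩⟩
  · exact mem_spectrum_iff_not_isUnit_sub.2 fun hunit => hS (.of_isUnit hunit)
  · exact hS (isLeftInvertibleModCompact_of_mem_discreteSpectrum hz)

theorem mem_essentialSpectrum_sum_iff {ι : Type*} [Fintype ι] {A : ι → H →L[ℂ] H}
    (hsa : ∀ i, IsSelfAdjoint (A i)) (hA : Pairwise fun i j => IsCompactOperator (A i * A j))
    {z : ℂ} (hz : z ≠ 0) : z ∈ essentialSpectrum (∑ i, A i) ↔ ∃ i, z ∈ essentialSpectrum (A i) := by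
  simp only [mem_essentialSpectrum_iff (hsa _),
    mem_essentialSpectrum_iff (isSelfAdjoint_sum _ fun i _ => hsa i),
    IsLeftInvertibleModCompact.sum_sub_smul_one_iff hA hz, Finset.mem_univ, true_imp_iff,
    not_forall]

theorem mem_essentialSpectrum_conj_adjoint_iff {E : Type*} [NormedAddCommGroup E]
    [InnerProductSpace ℂ E] [CompleteSpace E] {J : E →L[ℂ] H} (hJ : J.adjoint ∘L J = 1)
    {M : E →L[ℂ] E} (hM : IsSelfAdjoint M) {z : ℂ} (hz : z ≠ 0) :
    z ∈ essentialSpectrum (J ∘L M ∘L J.adjoint) ↔ z ∈ essentialSpectrum M := by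
  rw [mem_essentialSpectrum_iff hM, mem_essentialSpectrum_iff (hM.conj_adjoint J),
    IsLeftInvertibleModCompact.conj_sub_smul_one_iff hJ M hz]

theorem isCompactOperator_conj_adjoint_mul {E F : Type*} [NormedAddCommGroup E]
    [InnerProductSpace ℂ E] [CompleteSpace E] [NormedAddCommGroup F] [InnerProductSpace ℂ F]
    [CompleteSpace F] {J : E →L[ℂ] H} {L : F →L[ℂ] H} (hJL : IsCompactOperator (J.adjoint ∘L L))
    (M : E →L[ℂ] E) (N : F →L[ℂ] F) :
    IsCompactOperator ((J ∘L M ∘L J.adjoint) * (L ∘L N ∘L L.adjoint)) :=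
  (hJL.comp_clm (N ∘L L.adjoint)).clm_comp (J ∘L M)

end EssentialSpectrum

section Multiplication

theorem exists_measurableSet_subset_measure_lt {α : Type*} [MeasurableSpace α]
    [TopologicalSpace α] [SecondCountableTopology α] [TopologicalSpace.PseudoMetrizableSpace α]
    [BorelSpace α] {ν : Measure α} [SigmaFinite ν] [NullSingletonClass ν] {s : Set α}
    (hs : MeasurableSet s) (hs0 : ν s ≠ 0) {δ : ℝ≥0∞} (hδ : 0 < δ) :
    ∃ t ⊆ s, MeasurableSet t ∧ ν t ≠ 0 ∧ ν t < δ := by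
  obtain ⟨r, hr, hrs, hr0, hr_lt⟩ := Measure.exists_subset_measure_lt_top hs (pos_iff_ne_zero.2 hs0)
  have : IsFiniteMeasure (ν.restrict r) := ⟨by simpa using hr_lt⟩
  obtain ⟨x, -, hx⟩ := exists_mem_forall_mem_nhdsWithin_pos_measure hr0.ne'
  obtain ⟨U, hxU, hU, hUδ⟩ := Set.exists_isOpen_lt_of_lt (μ := ν.restrict r) {x} δ (by simpa)
  rw [Measure.restrict_apply hU.measurableSet, Set.inter_comm] at hUδ
  refine ⟨r ∩ U, Set.inter_subset_left.trans hrs, hr.inter hU.measurableSet, (hx _ ?_).ne', hUδ⟩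
  exact inter_mem_nhdsWithin _ (hU.mem_nhds (Set.singleton_subset_iff.1 hxU))

section Lp

variable {α : Type*} [MeasurableSpace α] {ν : Measure α} {p : ℝ≥0∞} [Fact (1 ≤ p)]

theorem exists_norm_eq_one_forall_notMem_eq_zero {𝕜 : Type*} [RCLike 𝕜] (hp : p ≠ ∞) {s : Set α}
    (hs : MeasurableSet s) (hs0 : ν s ≠ 0) (hs_top : ν s ≠ ∞) :
    ∃ x : Lp 𝕜 p ν, ‖x‖ = 1 ∧ ∀ᵐ a ∂ν, a ∉ s → x a = 0 := by
  have hp0 : p ≠ 0 := (zero_lt_one.trans_le Fact.out).ne'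
  have hpos : 0 < ν.real s ^ (1 / p.toReal) :=
    Real.rpow_pos_of_pos (ENNReal.toReal_pos hs0 hs_top) _
  refine ⟨indicatorConstLp p hs hs_top ((ν.real s ^ (1 / p.toReal))⁻¹ : ℝ), ?_,
    indicatorConstLp_coeFn_notMem⟩
  rw [norm_indicatorConstLp hp0 hp, RCLike.norm_ofReal, abs_of_pos (inv_pos.2 hpos),
    inv_mul_cancel₀ hpos.ne']

theorem eq_zero_of_tendsto_of_forall_notMem_eq_zero {E : Type*} [NormedAddCommGroup E]
    {x : ℕ → Lp E p ν} {y : Lp E p ν} (hy : Tendsto x atTop (𝓝 y)) {s : ℕ → Set α}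
    (hs : Tendsto (fun k => ν (s k)) atTop (𝓝 0)) (hx : ∀ k, ∀ᵐ a ∂ν, a ∉ s k → x k a = 0) :
    y = 0 := by
  have hzero : TendstoInMeasure ν (fun k => x k) atTop (0 : α → E) := fun ε hε => by
    refine tendsto_of_tendsto_of_tendsto_of_le_of_le tendsto_const_nhds hs (fun _ => zero_le)
      fun k => measure_mono_ae ?_
    filter_upwards [hx k] with a ha (hεa : ε ≤ edist (x k a) 0)
    by_contra hmem
    rw [ha hmem, edist_self] at hεa
    exact hε.not_ge hεa
  exact Lp.eq_zero_iff_ae_eq_zero.2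
    (tendstoInMeasure_ae_unique (tendstoInMeasure_of_tendsto_Lp hy) hzero)

theorem exists_norm_eq_one_forall_not_tendsto {𝕜 : Type*} [RCLike 𝕜] [TopologicalSpace α]
    [SecondCountableTopology α] [TopologicalSpace.PseudoMetrizableSpace α] [BorelSpace α]
    [SigmaFinite ν] [NullSingletonClass ν] (hp : p ≠ ∞) {s : ℕ → Set α}
    (hs : ∀ k, MeasurableSet (s k)) (hs0 : ∀ k, ν (s k) ≠ 0) :
    ∃ x : ℕ → Lp 𝕜 p ν, (∀ k, ‖x k‖ = 1) ∧ (∀ k, ∀ᵐ a ∂ν, a ∉ s k → x k a = 0) ∧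
      ∀ ψ : ℕ → ℕ, StrictMono ψ → ∀ y, ¬ Tendsto (x ∘ ψ) atTop (𝓝 y) := by
  have hδ (k : ℕ) : (0 : ℝ≥0∞) < (k + 1 : ℝ≥0∞)⁻¹ := by simp
  choose t hts ht ht0 htδ using fun k =>
    exists_measurableSet_subset_measure_lt (hs k) (hs0 k) (hδ k)
  have ht_lim : Tendsto (fun k => ν (t k)) atTop (𝓝 0) := by
    refine tendsto_of_tendsto_of_tendsto_of_le_of_le tendsto_const_nhds
      ((tendsto_add_atTop_iff_nat 1).2 ENNReal.tendsto_inv_nat_nhds_zero) (fun _ => zero_le)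
      fun k => ?_
    exact_mod_cast (htδ k).le
  choose x hx1 hx0 using fun k =>
    exists_norm_eq_one_forall_notMem_eq_zero (𝕜 := 𝕜) hp (ht k) (ht0 k) (htδ k).ne_top
  refine ⟨x, hx1, fun k => ?_, fun ψ hψ y hy => ?_⟩
  · filter_upwards [hx0 k] with a ha has using ha fun hat => has (hts k hat)
  · have hy0 : y = 0 := eq_zero_of_tendsto_of_forall_notMem_eq_zero hy
      (ht_lim.comp hψ.tendsto_atTop) fun k => hx0 (ψ k)
    have hy1 : ‖y‖ = 1 := tendsto_nhds_unique hy.norm (by simp [hx1])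
    simp [hy0] at hy1

theorem not_finiteDimensional_Lp {𝕜 : Type*} [RCLike 𝕜] [TopologicalSpace α]
    [SecondCountableTopology α] [TopologicalSpace.PseudoMetrizableSpace α] [BorelSpace α]
    [SigmaFinite ν] [NullSingletonClass ν] (hp : p ≠ ∞) (hν : ν ≠ 0) :
    ¬ FiniteDimensional 𝕜 (Lp 𝕜 p ν) := by
  intro hfin
  have : ProperSpace (Lp 𝕜 p ν) := FiniteDimensional.proper 𝕜 _
  obtain ⟨x, hx1, -, hx⟩ := exists_norm_eq_one_forall_not_tendsto (𝕜 := 𝕜) (ν := ν) hp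
    (s := fun _ => Set.univ) (fun _ => .univ) fun _ => by simpa using hν
  obtain ⟨y, -, ψ, hψ, hy⟩ := (isCompact_closedBall (0 : Lp 𝕜 p ν) 1).tendsto_subseq (x := x)
    fun k => by simp [hx1]
  exact hx ψ hψ y hy

end Lp

variable {α : Type*} [MeasurableSpace α] {ν : Measure α}

/-- Multiplication by an essentially bounded real function on complex `L²`. -/
noncomputable def mulOp (h : Lp ℝ ∞ ν) : Lp ℂ 2 ν →L[ℂ] Lp ℂ 2 ν :=
  (ContinuousLinearMap.mul ℂ ℂ).holderL ν ∞ 2 2 ((Lp.memLp h).ofReal.toLp _)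

theorem mulOp_ae_eq (h : Lp ℝ ∞ ν) (v : Lp ℂ 2 ν) : mulOp h v =ᵐ[ν] fun y => (h y : ℂ) * v y := by
  filter_upwards [(ContinuousLinearMap.mul ℂ ℂ).coeFn_holder (r := 2)
    ((Lp.memLp h).ofReal.toLp _) v, (Lp.memLp h).ofReal (K := ℂ) |>.coeFn_toLp] with y hmul hh
  exact hmul.trans (by rw [hh]; rfl)

theorem mulOp_sub_smul_one_ae_eq (h : Lp ℝ ∞ ν) (z : ℂ) (v : Lp ℂ 2 ν) :
    (mulOp h - z • 1) v =ᵐ[ν] fun y => ((h y : ℂ) - z) * v y := by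
  filter_upwards [mulOp_ae_eq h v, Lp.coeFn_smul z v, Lp.coeFn_sub (mulOp h v) (z • v)]
    with y hmul hsmul hsub
  have happly : (mulOp h - z • 1) v = mulOp h v - z • v := rfl
  rw [happly, hsub, Pi.sub_apply, hmul, hsmul, Pi.smul_apply, smul_eq_mul, sub_mul]

theorem isSelfAdjoint_mulOp (h : Lp ℝ ∞ ν) : IsSelfAdjoint (mulOp h) := by
  rw [ContinuousLinearMap.isSelfAdjoint_iff_isSymmetric]
  intro v w
  change inner ℂ (mulOp h v) w = inner ℂ v (mulOp h w)
  rw [L2.inner_def, L2.inner_def]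
  refine integral_congr_ae ?_
  filter_upwards [mulOp_ae_eq h v, mulOp_ae_eq h w] with y hv hw
  rw [hv, hw]
  simp only [RCLike.inner_apply, map_mul, Complex.conj_ofReal]
  ring

theorem spectrum_mulOp_subset (h : Lp ℝ ∞ ν) :
    spectrum ℂ (mulOp h) ⊆ Complex.ofReal '' essRan ν h := by
  intro z hz
  have hz_re : z = z.re := (isSelfAdjoint_mulOp h).mem_spectrum_eq_re hz
  refine ⟨z.re, ?_, hz_re.symm⟩
  by_contra hess
  simp only [essRan, Set.mem_ofPred_eq, not_forall, not_lt, nonpos_iff_eq_zero] at hess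
  obtain ⟨ε, hε, hnull⟩ := hess
  have hfar : ∀ᵐ y ∂ν, ε ≤ |h y - z.re| := by
    filter_upwards [measure_eq_zero_iff_ae_notMem.1 hnull] with y hy
    by_contra! hlt
    rw [abs_lt] at hlt
    exact hy ⟨by linarith, by linarith⟩
  have hbelow (v : Lp ℂ 2 ν) : ‖v‖ ≤ ε⁻¹ * ‖(mulOp h - z • 1) v‖ := by
    refine Lp.norm_le_mul_norm_of_ae_le_mul ?_
    filter_upwards [hfar, mulOp_sub_smul_one_ae_eq h z v] with y hy hv
    rw [hv, hz_re, ← Complex.ofReal_sub, norm_mul, Complex.norm_real, Real.norm_eq_abs,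
      ← mul_assoc]
    refine le_mul_of_one_le_left (norm_nonneg _) ?_
    rwa [le_inv_mul_iff₀ hε, mul_one]
  exact mem_spectrum_iff_not_isUnit_sub.1 hz (isUnit_of_antilipschitzWith
    (isSelfAdjoint_sub_smul_one_of_mem_spectrum (isSelfAdjoint_mulOp h) hz)
    (ContinuousLinearMap.antilipschitz_of_bound _ (K := ⟨ε⁻¹, by positivity⟩) hbelow))

variable [TopologicalSpace α] [SecondCountableTopology α]
  [TopologicalSpace.PseudoMetrizableSpace α] [BorelSpace α] [SigmaFinite ν] [NullSingletonClass ν]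

theorem not_isLeftInvertibleModCompact_mulOp_sub {h : Lp ℝ ∞ ν} {r : ℝ} (hr : r ∈ essRan ν h) :
    ¬ IsLeftInvertibleModCompact (mulOp h - (r : ℂ) • 1) := by
  intro hS
  have hmeas : Measurable h := (Lp.stronglyMeasurable h).measurable
  let ε (k : ℕ) : ℝ := 1 / (k + 1)
  have hε (k : ℕ) : 0 < ε k := Nat.one_div_pos_of_nat
  obtain ⟨x, hx1, hx0, hx⟩ := exists_norm_eq_one_forall_not_tendsto (𝕜 := ℂ) (p := 2)
    ENNReal.ofNat_ne_top (s := fun k => h ⁻¹' Set.Ioo (r - ε k) (r + ε k))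
    (fun k => hmeas measurableSet_Ioo) fun k => (hr _ (hε k)).ne'
  have hlim : Tendsto (fun k => (mulOp h - (r : ℂ) • 1) (x k)) atTop (𝓝 0) := by
    refine squeeze_zero_norm (fun k => ?_) tendsto_one_div_add_atTop_nhds_zero_nat
    refine (Lp.norm_le_mul_norm_of_ae_le_mul (c := ε k) (g := x k) ?_).trans_eq
      (by rw [hx1, mul_one])
    filter_upwards [hx0 k, mulOp_sub_smul_one_ae_eq h r (x k)] with y hy hv
    rw [hv, norm_mul, ← Complex.ofReal_sub, Complex.norm_real, Real.norm_eq_abs]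
    by_cases hmem : y ∈ h ⁻¹' Set.Ioo (r - ε k) (r + ε k)
    · gcongr
      exact (abs_sub_lt_iff.2 ⟨by linarith [hmem.2], by linarith [hmem.1]⟩).le
    · simp [hy hmem]
  obtain ⟨y, ψ, hψ, hy⟩ := hS.exists_tendsto_subseq (fun k => (hx1 k).le) hlim
  exact hx ψ hψ y hy

theorem essentialSpectrum_mulOp (h : Lp ℝ ∞ ν) :
    essentialSpectrum (mulOp h) = Complex.ofReal '' essRan ν h := by
  refine Set.Subset.antisymm (Set.sdiff_subset.trans (spectrum_mulOp_subset h)) ?_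
  rintro _ ⟨r, hr, rfl⟩
  exact (mem_essentialSpectrum_iff (isSelfAdjoint_mulOp h)).2
    (not_isLeftInvertibleModCompact_mulOp_sub hr)

end Multiplication

section TensorProduct

theorem exists_norm_eq_one_forall_inner_eq_zero {𝕜 H ι : Type*} [RCLike 𝕜] [NormedAddCommGroup H]
    [InnerProductSpace 𝕜 H] [Finite ι] (hH : ¬ FiniteDimensional 𝕜 H) (φ : ι → H) :
    ∃ u : H, ‖u‖ = 1 ∧ ∀ i, ⟪φ i, u⟫_𝕜 = 0 := by
  let N := Submodule.span 𝕜 (Set.range φ)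
  have hN : FiniteDimensional 𝕜 N := FiniteDimensional.span_of_finite 𝕜 (Set.finite_range φ)
  have hbot : Nᗮ ≠ ⊥ := fun hbot => by
    rw [Submodule.orthogonal_eq_bot_iff] at hbot
    rw [hbot] at hN
    exact hH (LinearEquiv.finiteDimensional Submodule.topEquiv)
  obtain ⟨u, hu, hu0⟩ := Submodule.exists_mem_ne_zero_of_ne_bot hbot
  refine ⟨(‖u‖⁻¹ : 𝕜) • u, norm_smul_inv_norm hu0, fun i => ?_⟩
  rw [inner_smul_right, hu _ (Submodule.subset_span (Set.mem_range_self i)), mul_zero]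

theorem isCompactOperator_rankOne {𝕜 E F : Type*} [RCLike 𝕜] [NormedAddCommGroup E]
    [InnerProductSpace 𝕜 E] [NormedAddCommGroup F] [InnerProductSpace 𝕜 F] (x : E) (y : F) :
    IsCompactOperator (InnerProductSpace.rankOne 𝕜 x y) :=
  isCompactOperator_of_forall_mem (N := Submodule.span 𝕜 {x}) fun _ =>
    Submodule.smul_mem _ _ (Submodule.mem_span_singleton_self x)

variable {μ ν : Measure ℝ} [SFinite μ] [SFinite ν]

theorem memLp_two_prod_mul (u : Lp ℂ 2 μ) (v : Lp ℂ 2 ν) :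
    MemLp (fun z : ℝ × ℝ => u z.1 * v z.2) 2 (μ.prod ν) :=
  ⟨(Lp.memLp u).1.comp_fst.mul (Lp.memLp v).1.comp_snd, by
    rw [eLpNorm_two_prod_mul (Lp.memLp u).1 (Lp.memLp v).1]
    exact ENNReal.mul_lt_top (Lp.memLp u).2 (Lp.memLp v).2⟩

/-- Tensoring with `u` on the left: `v ↦ u ⊗ v`, where `(u ⊗ v) (x, y) = u x * v y`. -/
noncomputable def tensorLeft (u : Lp ℂ 2 μ) : Lp ℂ 2 ν →L[ℂ] Lp ℂ 2 (μ.prod ν) :=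
  LinearMap.mkContinuous
    { toFun := fun v => (memLp_two_prod_mul u v).toLp _
      map_add' := fun v w => by
        rw [← MemLp.toLp_add]
        refine MemLp.toLp_congr _ _ ?_
        filter_upwards [ae_prod_snd (Lp.coeFn_add v w)] with z hz
        simp only [hz, Pi.add_apply, mul_add]
      map_smul' := fun c v => by
        rw [RingHom.id_apply, ← MemLp.toLp_const_smul]
        refine MemLp.toLp_congr _ _ ?_
        filter_upwards [ae_prod_snd (Lp.coeFn_smul c v)] with z hz
        simp only [hz, Pi.smul_apply, mul_smul_comm] }
    ‖u‖ fun v => by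
      simp only [LinearMap.coe_mk, AddHom.coe_mk]
      rw [Lp.norm_toLp, eLpNorm_two_prod_mul (Lp.memLp u).1 (Lp.memLp v).1, ENNReal.toReal_mul,
        Lp.norm_def, Lp.norm_def]

theorem tensorLeft_ae_eq (u : Lp ℂ 2 μ) (v : Lp ℂ 2 ν) :
    tensorLeft u v =ᵐ[μ.prod ν] fun z => u z.1 * v z.2 :=
  (memLp_two_prod_mul u v).coeFn_toLp

theorem inner_tensorLeft (u u' : Lp ℂ 2 μ) (v v' : Lp ℂ 2 ν) :
    ⟪tensorLeft u v, tensorLeft u' v'⟫_ℂ = ⟪u, u'⟫_ℂ * ⟪v, v'⟫_ℂ := by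
  rw [L2.inner_def, L2.inner_def, L2.inner_def, ← integral_prod_mul]
  refine integral_congr_ae ?_
  filter_upwards [tensorLeft_ae_eq u v, tensorLeft_ae_eq u' v'] with z h h'
  simp only [h, h', RCLike.inner_apply, map_mul]
  ring

theorem adjoint_tensorLeft_apply_tensorLeft (u u' : Lp ℂ 2 μ) (v : Lp ℂ 2 ν) :
    (tensorLeft u).adjoint (tensorLeft u' v) = ⟪u, u'⟫_ℂ • v :=
  ext_inner_left ℂ fun w => by
    rw [ContinuousLinearMap.adjoint_inner_right, inner_tensorLeft, inner_smul_right]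

theorem adjoint_tensorLeft_comp_tensorLeft (u u' : Lp ℂ 2 μ) :
    (tensorLeft (ν := ν) u).adjoint ∘L tensorLeft u' = ⟪u, u'⟫_ℂ • 1 :=
  ContinuousLinearMap.ext (adjoint_tensorLeft_apply_tensorLeft u u')

theorem adjoint_tensorLeft_comp_self {u : Lp ℂ 2 μ} (hu : ‖u‖ = 1) :
    (tensorLeft (ν := ν) u).adjoint ∘L tensorLeft u = 1 := by
  rw [adjoint_tensorLeft_comp_tensorLeft, inner_self_eq_one_of_norm_eq_one hu, one_smul]

theorem adjoint_tensorLeft_ae_eq (u : Lp ℂ 2 μ) (f : Lp ℂ 2 (μ.prod ν)) :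
    (tensorLeft u).adjoint f =ᵐ[ν] sliceCoeff u f := by
  have hmem := memLp_sliceCoeff u (Lp.memLp f)
  suffices h : (tensorLeft u).adjoint f = hmem.toLp _ by
    rw [h]
    exact hmem.coeFn_toLp
  refine ext_inner_left ℂ fun v => ?_
  rw [ContinuousLinearMap.adjoint_inner_right, L2.inner_def,
    integral_prod_symm _ (L2.integrable_inner _ _), L2.inner_def]
  refine integral_congr_ae ?_
  filter_upwards [hmem.coeFn_toLp, ae_ae_slice (tensorLeft_ae_eq u v)] with y hy hslice
  rw [hy, sliceCoeff, RCLike.inner_apply, ← integral_mul_const]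
  refine integral_congr_ae ?_
  filter_upwards [hslice] with s hs
  rw [hs, RCLike.inner_apply, map_mul]
  ring

/-- Exchange of the two variables, as a unitary operator between the `L²` spaces of the product. -/
noncomputable def swapLp (μ ν : Measure ℝ) [SFinite μ] [SFinite ν] :
    Lp ℂ 2 (μ.prod ν) ≃ₗᵢ[ℂ] Lp ℂ 2 (ν.prod μ) where
  __ := Lp.compMeasurePreservingₗᵢ ℂ Prod.swap Measure.measurePreserving_swap
  invFun := Lp.compMeasurePreservingₗᵢ ℂ Prod.swap Measure.measurePreserving_swap
  left_inv f := (Lp.compMeasurePreserving_comp_apply f Measure.measurePreserving_swap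
    Measure.measurePreserving_swap).symm.trans (Lp.compMeasurePreserving_id_apply f)
  right_inv f := (Lp.compMeasurePreserving_comp_apply f Measure.measurePreserving_swap
    Measure.measurePreserving_swap).symm.trans (Lp.compMeasurePreserving_id_apply f)

theorem swapLp_ae_eq (f : Lp ℂ 2 (μ.prod ν)) : swapLp μ ν f =ᵐ[ν.prod μ] f ∘ Prod.swap :=
  Lp.coeFn_compMeasurePreserving f Measure.measurePreserving_swap

theorem swapLp_tensorLeft (u : Lp ℂ 2 μ) (v : Lp ℂ 2 ν) :
    swapLp μ ν (tensorLeft u v) = tensorLeft v u := by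
  refine Lp.ext ?_
  filter_upwards [swapLp_ae_eq (tensorLeft u v), tensorLeft_ae_eq v u,
    Measure.measurePreserving_swap.quasiMeasurePreserving.ae (tensorLeft_ae_eq u v)]
    with z hswap hvu huv
  rw [hswap, hvu, Function.comp_apply, huv, mul_comm, Prod.fst_swap, Prod.snd_swap]

/-- Tensoring with `v` on the right: `u ↦ u ⊗ v`, where `(u ⊗ v) (x, y) = u x * v y`. -/
noncomputable def tensorRight (v : Lp ℂ 2 ν) : Lp ℂ 2 μ →L[ℂ] Lp ℂ 2 (μ.prod ν) :=
  (swapLp ν μ).toContinuousLinearEquiv ∘L tensorLeft v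

theorem tensorRight_apply (u : Lp ℂ 2 μ) (v : Lp ℂ 2 ν) : tensorRight v u = tensorLeft u v :=
  swapLp_tensorLeft v u

theorem adjoint_tensorRight (v : Lp ℂ 2 ν) :
    (tensorRight (μ := μ) v).adjoint =
      (tensorLeft v).adjoint ∘L (swapLp μ ν).toContinuousLinearEquiv := by
  rw [tensorRight, ContinuousLinearMap.adjoint_comp]
  exact congrArg _ (LinearIsometryEquiv.adjoint_eq_symm (swapLp ν μ))

theorem adjoint_tensorRight_comp_tensorRight (v v' : Lp ℂ 2 ν) :
    (tensorRight (μ := μ) v).adjoint ∘L tensorRight v' = ⟪v, v'⟫_ℂ • 1 := by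
  ext1 u
  simp only [adjoint_tensorRight, ContinuousLinearMap.comp_apply, tensorRight_apply]
  exact (congrArg _ (swapLp_tensorLeft u v')).trans (adjoint_tensorLeft_apply_tensorLeft v v' u)

theorem adjoint_tensorRight_comp_self {v : Lp ℂ 2 ν} (hv : ‖v‖ = 1) :
    (tensorRight (μ := μ) v).adjoint ∘L tensorRight v = 1 := by
  rw [adjoint_tensorRight_comp_tensorRight, inner_self_eq_one_of_norm_eq_one hv, one_smul]

theorem adjoint_tensorLeft_comp_tensorRight (u : Lp ℂ 2 μ) (v : Lp ℂ 2 ν) :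
    (tensorLeft u).adjoint ∘L tensorRight v = InnerProductSpace.rankOne ℂ v u := by
  ext1 w
  rw [ContinuousLinearMap.comp_apply, tensorRight_apply, adjoint_tensorLeft_apply_tensorLeft,
    InnerProductSpace.rankOne_apply]

theorem adjoint_tensorRight_comp_tensorLeft (u : Lp ℂ 2 μ) (v : Lp ℂ 2 ν) :
    (tensorRight v).adjoint ∘L tensorLeft u = InnerProductSpace.rankOne ℂ u v := by
  rw [← InnerProductSpace.adjoint_rankOne, ← adjoint_tensorLeft_comp_tensorRight,
    ContinuousLinearMap.adjoint_comp, ContinuousLinearMap.adjoint_adjoint]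

end TensorProduct

section PartialIntegralOperators

variable {μ ν : Measure ℝ}

section SFinite

variable [SFinite μ] [SFinite ν] {n m : ℕ}

theorem tensorLeft_conj_mulOp_ae_eq (u : Lp ℂ 2 μ) (h : Lp ℝ ∞ ν) (f : Lp ℂ 2 (μ.prod ν)) :
    tensorLeft u (mulOp h ((tensorLeft u).adjoint f)) =ᵐ[μ.prod ν] degenerateTerm u h f := by
  filter_upwards [tensorLeft_ae_eq u (mulOp h ((tensorLeft u).adjoint f)),
    ae_prod_snd (mulOp_ae_eq h ((tensorLeft u).adjoint f)),
    ae_prod_snd (adjoint_tensorLeft_ae_eq u f)] with z htensor hmul hadj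
  rw [htensor, hmul, hadj, degenerateTerm]

theorem partialIntegralOp₁_eq_sum (φ : Fin n → Lp ℂ 2 μ) (h : Fin n → Lp ℝ ∞ ν) :
    partialIntegralOp₁ φ h =
      ∑ i, tensorLeft (φ i) ∘L mulOp (h i) ∘L (tensorLeft (φ i)).adjoint := by
  ext1 f
  simp only [sum_apply, ContinuousLinearMap.comp_apply]
  refine Lp.ext ?_
  filter_upwards [partialIntegralOp₁_ae_eq φ h f, partialInt₁_ae_eq_sum φ h (Lp.memLp f),
    Lp.coeFn_fun_finsetSum Finset.univ fun i =>
      tensorLeft (φ i) (mulOp (h i) ((tensorLeft (φ i)).adjoint f)),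
    ae_all_iff.2 fun i => tensorLeft_conj_mulOp_ae_eq (φ i) (h i) f] with z hop hint hsum hterm
  rw [hop, hint, hsum]
  exact Finset.sum_congr rfl fun i _ => (hterm i).symm

theorem partialIntegralOp₂_apply_eq_swapLp (p : Fin m → Lp ℝ ∞ μ) (ψ : Fin m → Lp ℂ 2 ν)
    (f : Lp ℂ 2 (μ.prod ν)) :
    partialIntegralOp₂ p ψ f = swapLp ν μ (partialIntegralOp₁ ψ p (swapLp μ ν f)) := by
  have hswap : partialIntegralOp₁ ψ p (swapLp μ ν f) =ᵐ[ν.prod μ]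
      partialInt₁ ν (degenerateKernel₁ ψ p) (f ∘ Prod.swap) :=
    (partialIntegralOp₁_ae_eq ψ p _).trans (partialInt₁_congr _ (swapLp_ae_eq f))
  refine Lp.ext ?_
  filter_upwards [partialIntegralOp₂_ae_eq p ψ f, swapLp_ae_eq (partialIntegralOp₁ ψ p _),
    Measure.measurePreserving_swap.quasiMeasurePreserving.ae hswap] with z hop hcomp hz
  rw [hop, hcomp, partialInt₂_eq_swap, Function.comp_apply, Function.comp_apply, hz]

theorem partialIntegralOp₂_eq_sum (p : Fin m → Lp ℝ ∞ μ) (ψ : Fin m → Lp ℂ 2 ν) :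
    partialIntegralOp₂ p ψ =
      ∑ j, tensorRight (ψ j) ∘L mulOp (p j) ∘L (tensorRight (ψ j)).adjoint := by
  ext1 f
  rw [partialIntegralOp₂_apply_eq_swapLp, partialIntegralOp₁_eq_sum]
  simp only [sum_apply, map_sum, adjoint_tensorRight]
  rfl

theorem isSelfAdjoint_partialIntegralOp₁ (φ : Fin n → Lp ℂ 2 μ) (h : Fin n → Lp ℝ ∞ ν) :
    IsSelfAdjoint (partialIntegralOp₁ φ h) := by
  rw [partialIntegralOp₁_eq_sum]
  exact isSelfAdjoint_sum _ fun i _ => (isSelfAdjoint_mulOp (h i)).conj_adjoint _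

theorem isSelfAdjoint_partialIntegralOp₂ (p : Fin m → Lp ℝ ∞ μ) (ψ : Fin m → Lp ℂ 2 ν) :
    IsSelfAdjoint (partialIntegralOp₂ p ψ) := by
  rw [partialIntegralOp₂_eq_sum]
  exact isSelfAdjoint_sum _ fun j _ => (isSelfAdjoint_mulOp (p j)).conj_adjoint _

theorem partialIntegralOp₁_comp_tensorLeft_eq_zero {φ : Fin n → Lp ℂ 2 μ} {u : Lp ℂ 2 μ}
    (hu : ∀ i, ⟪φ i, u⟫_ℂ = 0) (h : Fin n → Lp ℝ ∞ ν) :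
    partialIntegralOp₁ φ h ∘L tensorLeft u = 0 := by
  rw [partialIntegralOp₁_eq_sum, ContinuousLinearMap.finsetSum_comp]
  refine Finset.sum_eq_zero fun i _ => ?_
  simp only [ContinuousLinearMap.comp_assoc, adjoint_tensorLeft_comp_tensorLeft, hu i, zero_smul,
    ContinuousLinearMap.comp_zero]

theorem isCompactOperator_partialIntegralOp₂_comp_tensorLeft (p : Fin m → Lp ℝ ∞ μ)
    (ψ : Fin m → Lp ℂ 2 ν) (u : Lp ℂ 2 μ) :
    IsCompactOperator (partialIntegralOp₂ p ψ ∘L tensorLeft u) := by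
  rw [partialIntegralOp₂_eq_sum, ContinuousLinearMap.finsetSum_comp]
  refine (compactOperator (RingHom.id ℂ) (Lp ℂ 2 ν) (Lp ℂ 2 (μ.prod ν))).sum_mem fun j _ => ?_
  simp only [ContinuousLinearMap.comp_assoc, adjoint_tensorRight_comp_tensorLeft,
    InnerProductSpace.comp_rankOne]
  exact isCompactOperator_rankOne _ _

end SFinite

variable [SigmaFinite μ] [NullSingletonClass μ] [SigmaFinite ν] [NullSingletonClass ν] {n m : ℕ}

theorem zero_mem_essentialSpectrum_partialIntegralOp_add (hμ : μ ≠ 0) (hν : ν ≠ 0)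
    (φ : Fin n → Lp ℂ 2 μ) (h : Fin n → Lp ℝ ∞ ν) (ψ : Fin m → Lp ℂ 2 ν) (p : Fin m → Lp ℝ ∞ μ) :
    0 ∈ essentialSpectrum (partialIntegralOp₁ φ h + partialIntegralOp₂ p ψ) := by
  obtain ⟨u, hu, hφu⟩ := exists_norm_eq_one_forall_inner_eq_zero
    (not_finiteDimensional_Lp (𝕜 := ℂ) (p := 2) ENNReal.ofNat_ne_top hμ) φ
  have hcompact : IsCompactOperator
      ((partialIntegralOp₁ φ h + partialIntegralOp₂ p ψ) ∘L tensorLeft u) := by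
    rw [ContinuousLinearMap.add_comp, partialIntegralOp₁_comp_tensorLeft_eq_zero hφu, zero_add]
    exact isCompactOperator_partialIntegralOp₂_comp_tensorLeft p ψ u
  rw [mem_essentialSpectrum_iff
    ((isSelfAdjoint_partialIntegralOp₁ φ h).add (isSelfAdjoint_partialIntegralOp₂ p ψ)),
    zero_smul, sub_zero]
  exact not_isLeftInvertibleModCompact_of_comp
    (not_finiteDimensional_Lp (𝕜 := ℂ) (p := 2) ENNReal.ofNat_ne_top hν)
    (adjoint_tensorLeft_comp_self hu) hcompact

theorem mem_essentialSpectrum_partialIntegralOp_add_iff {φ : Fin n → Lp ℂ 2 μ}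
    (hφ : Orthonormal ℂ φ) (h : Fin n → Lp ℝ ∞ ν) {ψ : Fin m → Lp ℂ 2 ν} (hψ : Orthonormal ℂ ψ)
    (p : Fin m → Lp ℝ ∞ μ) {z : ℂ} (hz : z ≠ 0) :
    z ∈ essentialSpectrum (partialIntegralOp₁ φ h + partialIntegralOp₂ p ψ) ↔
      (∃ i, z ∈ Complex.ofReal '' essRan ν (h i)) ∨
        ∃ j, z ∈ Complex.ofReal '' essRan μ (p j) := by
  let A : Fin n ⊕ Fin m → Lp ℂ 2 (μ.prod ν) →L[ℂ] Lp ℂ 2 (μ.prod ν) := Sum.elim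
    (fun i => tensorLeft (φ i) ∘L mulOp (h i) ∘L (tensorLeft (φ i)).adjoint)
    fun j => tensorRight (ψ j) ∘L mulOp (p j) ∘L (tensorRight (ψ j)).adjoint
  have hsum : partialIntegralOp₁ φ h + partialIntegralOp₂ p ψ = ∑ k, A k := by
    rw [partialIntegralOp₁_eq_sum, partialIntegralOp₂_eq_sum, Fintype.sum_sum_type]
    rfl
  have hsa : ∀ k, IsSelfAdjoint (A k) := by
    rintro (i | j)
    exacts [(isSelfAdjoint_mulOp (h i)).conj_adjoint _, (isSelfAdjoint_mulOp (p j)).conj_adjoint _]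
  have hA : Pairwise fun k l => IsCompactOperator (A k * A l) := by
    rintro (i | j) (i' | j') hne <;> refine isCompactOperator_conj_adjoint_mul ?_ _ _
    · rw [adjoint_tensorLeft_comp_tensorLeft, hφ.2 (Sum.inl_injective.ne_iff.1 hne), zero_smul]
      exact isCompactOperator_zero
    · rw [adjoint_tensorLeft_comp_tensorRight]
      exact isCompactOperator_rankOne _ _
    · rw [adjoint_tensorRight_comp_tensorLeft]
      exact isCompactOperator_rankOne _ _
    · rw [adjoint_tensorRight_comp_tensorRight, hψ.2 (Sum.inr_injective.ne_iff.1 hne), zero_smul]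
      exact isCompactOperator_zero
  rw [hsum, mem_essentialSpectrum_sum_iff hsa hA hz, Sum.exists]
  refine or_congr (exists_congr fun i => ?_) (exists_congr fun j => ?_)
  · exact (mem_essentialSpectrum_conj_adjoint_iff (adjoint_tensorLeft_comp_self (hφ.1 i))
      (isSelfAdjoint_mulOp (h i)) hz).trans (by rw [essentialSpectrum_mulOp])
  · exact (mem_essentialSpectrum_conj_adjoint_iff (adjoint_tensorRight_comp_self (hψ.1 j))
      (isSelfAdjoint_mulOp (p j)) hz).trans (by rw [essentialSpectrum_mulOp])

theorem theorem5p6_general (hμ : μ ≠ 0) (hν : ν ≠ 0)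
    {φ : Fin n → Lp ℂ 2 μ} (hφ : Orthonormal ℂ φ) (h : Fin n → Lp ℝ ∞ ν)
    {ψ : Fin m → Lp ℂ 2 ν} (hψ : Orthonormal ℂ ψ) (p : Fin m → Lp ℝ ∞ μ) :
    essentialSpectrum (partialIntegralOp₁ φ h + partialIntegralOp₂ p ψ) =
      {0} ∪ (⋃ i, Complex.ofReal '' essRan ν (h i)) ∪
        (⋃ j, Complex.ofReal '' essRan μ (p j)) := by
  ext z
  rw [Set.union_assoc, Set.mem_union, Set.mem_union, Set.mem_iUnion, Set.mem_iUnion,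
    Set.mem_singleton_iff]
  obtain rfl | hz := eq_or_ne z 0
  · exact iff_of_true (zero_mem_essentialSpectrum_partialIntegralOp_add hμ hν φ h ψ p) (.inl rfl)
  · rw [mem_essentialSpectrum_partialIntegralOp_add_iff hφ h hψ p hz, or_iff_right hz]

end PartialIntegralOperators

theorem intervalMeasure_ne_zero {a b : ℝ} (hab : a < b) : intervalMeasure a b ≠ 0 := by
  rw [intervalMeasure, Ne, Measure.restrict_eq_zero, Real.volume_Icc]
  simpa using hab

theorem theorem5p6 (a b c d : ℝ) (hab : a < b) (hcd : c < d) (n m : ℕ)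
    (φ : Fin n → Lp ℂ 2 (intervalMeasure a b)) (hφ : Orthonormal ℂ φ)
    (h : Fin n → Lp ℝ ∞ (intervalMeasure c d))
    (ψ : Fin m → Lp ℂ 2 (intervalMeasure c d)) (hψ : Orthonormal ℂ ψ)
    (p : Fin m → Lp ℝ ∞ (intervalMeasure a b)) :
    essentialSpectrum (partialIntegralOp₁ φ h + partialIntegralOp₂ p ψ) =
      {0} ∪ (⋃ i, Complex.ofReal '' essRan (intervalMeasure c d) (h i)) ∪
        (⋃ j, Complex.ofReal '' essRan (intervalMeasure a b) (p j)) :=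
  theorem5p6_general (intervalMeasure_ne_zero hab) (intervalMeasure_ne_zero hcd) hφ h hψ p
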